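/- Let $F$ be a field of characteristic different from $2$. Algebras over $F$ are finite-dimensional, unital and not necessarily associative, and subalgebras are required to contain the unit element. An involution of an algebra $A$ is a linear map $a \mapsto a^*$ with $(ab)^* = b^*a^*$ and $(a^*)^* = a$; it is called strong if $a^* = a$ holds exactly for $a \in F1$. For an algebra $A$ with a strong involution and $\gamma \in F \setminus \{0\}$, the Dickson double $D_\gamma(A)$ is the vector space $A \oplus iA$ with multiplication $$(a + ib)(c + id) = (ac + \gamma d b^*) + i(a^*d + cb)$$ and involution $(a + ib)^* = a^* - ib$. The Cayley-Dickson algebras over $F$ are, up to isomorphism of algebras with involution, those obtained from $F$ (with the identity as involution) by finitely many successive Dickson doublings, with arbitrary non-zero parameters $\gamma$. A Cayley algebra over $F$ is a Cayley-Dickson algebra of dimension $8$. Theorem. Let $O$ be a Cayley algebra over $F$ and let $A \subseteq O$ be a subalgebra. Then $A$ is associative if and only if $\dim_F A \leq 4$. In particular, every $4$-dimensional subalgebra of $O$ is associative. -/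

import Mathlib

/-!
Algebras over a field `F` are finite-dimensional, unital and not necessarily associative: they are
modelled by `[NonAssocRing A] [Module F A] [IsScalarTower F A A] [SMulCommClass F A A]`
(the last two classes say that the multiplication is `F`-bilinear).
-/

/-- An involution of a unital, not necessarily associative `F`-algebra: an `F`-linear
anti-automorphism whose square is the identity. -/
structure AlgInvolution (F A : Type*) [Field F] [NonAssocRing A] [Module F A] extends
    A →ₗ[F] A where
  map_mul_rev' : ∀ a b : A, toFun (a * b) = toFun b * toFun a
  involutive' : ∀ a : A, toFun (toFun a) = a

namespace AlgInvolution

variable {F A : Type*} [Field F] [NonAssocRing A] [Module F A]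

instance : CoeFun (AlgInvolution F A) (fun _ => A → A) := ⟨fun σ => σ.toLinearMap⟩

theorem map_mul_rev (σ : AlgInvolution F A) (a b : A) : σ (a * b) = σ b * σ a :=
  σ.map_mul_rev' a b

theorem invol (σ : AlgInvolution F A) (a : A) : σ (σ a) = a := σ.involutive' a

theorem map_one (σ : AlgInvolution F A) : σ 1 = 1 := by
  have h := σ.map_mul_rev (σ 1) 1
  rwa [mul_one, σ.invol, mul_one, eq_comm] at h

/-- An involution is strong if its fixed points are exactly the scalar multiples of `1`. -/
def IsStrong (σ : AlgInvolution F A) : Prop :=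
  ∀ a : A, σ a = a ↔ ∃ r : F, a = r • (1 : A)

end AlgInvolution

/-- The Dickson double `D_γ(A)` of an algebra `A` with involution `σ`: the vector space
`A ⊕ iA`, in which `⟨a, b⟩` stands for `a + ib`. -/
@[ext]
structure DicksonDouble {F A : Type*} [Field F] [NonAssocRing A] [Module F A]
    (σ : AlgInvolution F A) (γ : F) where
  fst : A
  snd : A

namespace DicksonDouble

variable {F A : Type*} [Field F] [NonAssocRing A] [Module F A]
  {σ : AlgInvolution F A} {γ : F}

instance : Zero (DicksonDouble σ γ) := ⟨⟨0, 0⟩⟩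
instance : One (DicksonDouble σ γ) := ⟨⟨1, 0⟩⟩
instance : Add (DicksonDouble σ γ) := ⟨fun x y => ⟨x.fst + y.fst, x.snd + y.snd⟩⟩
instance : Neg (DicksonDouble σ γ) := ⟨fun x => ⟨-x.fst, -x.snd⟩⟩
instance : SMul F (DicksonDouble σ γ) := ⟨fun r x => ⟨r • x.fst, r • x.snd⟩⟩

/-- `(a + ib)(c + id) = (ac + γ d b*) + i(a* d + cb)`. -/
instance : Mul (DicksonDouble σ γ) :=
  ⟨fun x y => ⟨x.fst * y.fst + γ • (y.snd * σ x.snd), σ x.fst * y.snd + y.fst * x.snd⟩⟩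

@[simp] theorem fst_zero : (0 : DicksonDouble σ γ).fst = 0 := rfl
@[simp] theorem snd_zero : (0 : DicksonDouble σ γ).snd = 0 := rfl
@[simp] theorem fst_one : (1 : DicksonDouble σ γ).fst = 1 := rfl
@[simp] theorem snd_one : (1 : DicksonDouble σ γ).snd = 0 := rfl
@[simp] theorem fst_add (x y : DicksonDouble σ γ) : (x + y).fst = x.fst + y.fst := rfl
@[simp] theorem snd_add (x y : DicksonDouble σ γ) : (x + y).snd = x.snd + y.snd := rfl
@[simp] theorem fst_neg (x : DicksonDouble σ γ) : (-x).fst = -x.fst := rfl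
@[simp] theorem snd_neg (x : DicksonDouble σ γ) : (-x).snd = -x.snd := rfl
@[simp] theorem fst_smul (r : F) (x : DicksonDouble σ γ) : (r • x).fst = r • x.fst := rfl
@[simp] theorem snd_smul (r : F) (x : DicksonDouble σ γ) : (r • x).snd = r • x.snd := rfl
@[simp] theorem fst_mul (x y : DicksonDouble σ γ) :
    (x * y).fst = x.fst * y.fst + γ • (y.snd * σ x.snd) := rfl
@[simp] theorem snd_mul (x y : DicksonDouble σ γ) :
    (x * y).snd = σ x.fst * y.snd + y.fst * x.snd := rfl

instance : AddCommGroup (DicksonDouble σ γ) where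
  add_assoc x y z := by ext <;> simp [add_assoc]
  zero_add x := by ext <;> simp
  add_zero x := by ext <;> simp
  add_comm x y := by ext <;> simp [add_comm]
  neg_add_cancel x := by ext <;> simp
  nsmul := nsmulRec
  zsmul := zsmulRec

instance : NonAssocRing (DicksonDouble σ γ) where
  left_distrib x y z := by
    ext <;> simp [mul_add, add_mul] <;> abel
  right_distrib x y z := by
    ext <;> simp [mul_add, add_mul] <;> abel
  zero_mul x := by ext <;> simp
  mul_zero x := by ext <;> simp
  one_mul x := by ext <;> simp [σ.map_one]
  mul_one x := by ext <;> simp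

instance : Module F (DicksonDouble σ γ) where
  one_smul x := by ext <;> simp
  mul_smul r s x := by ext <;> simp [mul_smul]
  smul_zero r := by ext <;> simp
  smul_add r x y := by ext <;> simp
  add_smul r s x := by ext <;> simp [add_smul]
  zero_smul x := by ext <;> simp

variable [IsScalarTower F A A] [SMulCommClass F A A]

instance : IsScalarTower F (DicksonDouble σ γ) (DicksonDouble σ γ) where
  smul_assoc r x y := by
    ext <;> simp [smul_mul_assoc, mul_smul_comm, smul_comm γ r]

instance : SMulCommClass F (DicksonDouble σ γ) (DicksonDouble σ γ) where
  smul_comm r x y := by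
    ext <;> simp [smul_mul_assoc, mul_smul_comm, smul_comm γ r]

/-- The involution of the Dickson double: it extends `σ` and sends `i` to `-i`, so
`(a + ib)* = a* - ib`. -/
def conj (σ : AlgInvolution F A) (γ : F) : AlgInvolution F (DicksonDouble σ γ) where
  toFun x := ⟨σ x.fst, -x.snd⟩
  map_add' x y := by ext <;> simp [add_comm]
  map_smul' r x := by ext <;> simp
  map_mul_rev' x y := by
    ext
    · simp [σ.map_mul_rev, σ.invol]
    · simp [σ.invol, add_comm]
  involutive' x := by ext <;> simp [σ.invol]

end DicksonDouble

universe u v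

/-- `IsCayleyDickson F A σ`: the `F`-algebra `A` with the involution `σ` is a Cayley-Dickson algebra,
i.e. it is either the one-dimensional algebra with the identity involution, or (isomorphic, as an
algebra with involution, to) the Dickson double of a Cayley-Dickson algebra, for some `γ ≠ 0`. -/
inductive IsCayleyDickson (F : Type u) [Field F] : (A : Type v) → [NonAssocRing A] →
    [Module F A] → [IsScalarTower F A A] → [SMulCommClass F A A] → AlgInvolution F A → Prop
  | base {A : Type v} [NonAssocRing A] [Module F A] [IsScalarTower F A A] [SMulCommClass F A A]
      (σ : AlgInvolution F A) (hdim : Module.finrank F A = 1) (hσ : ∀ a : A, σ a = a) :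
      IsCayleyDickson F A σ
  | double {A B : Type v} [NonAssocRing A] [Module F A] [IsScalarTower F A A] [SMulCommClass F A A]
      [NonAssocRing B] [Module F B] [IsScalarTower F B B] [SMulCommClass F B B]
      (σ : AlgInvolution F A) (τ : AlgInvolution F B) (γ : F) (hγ : γ ≠ 0)
      (hB : IsCayleyDickson F B τ) (e : DicksonDouble τ γ ≃ₗ[F] A)
      (he_mul : ∀ x y, e (x * y) = e x * e y)
      (he_conj : ∀ x, e (DicksonDouble.conj τ γ x) = σ (e x)) :
      IsCayleyDickson F A σ

/-- In characteristic different from `2`, the involution of a Cayley-Dickson algebra is strong (so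
that Dickson doubles are only formed of algebras with a strong involution). -/
theorem IsCayleyDickson.isStrong {F : Type u} [Field F] (hF : ringChar F ≠ 2) {A : Type v}
    [NonAssocRing A] [Module F A] [IsScalarTower F A A] [SMulCommClass F A A]
    {σ : AlgInvolution F A} (h : IsCayleyDickson F A σ) : σ.IsStrong := by
  have h2 : (2 : F) ≠ 0 := Ring.two_ne_zero hF
  induction h with
  | base σ hdim hσ =>
    rename_i A _ _ _ _
    intro a
    refine ⟨fun _ => ?_, fun _ => hσ a⟩
    have : Nontrivial A := Module.nontrivial_of_finrank_pos (R := F) (by omega)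
    obtain ⟨r, hr⟩ := exists_smul_eq_of_finrank_eq_one hdim (one_ne_zero (α := A)) a
    exact ⟨r, hr.symm⟩
  | double σ τ γ hγ hB e he_mul he_conj ih =>
    intro a
    have h1 : e 1 = 1 := by
      have := he_mul 1 (e.symm 1)
      rwa [one_mul, e.apply_symm_apply, mul_one, eq_comm] at this
    obtain ⟨x, rfl⟩ := e.surjective a
    rw [← he_conj, e.injective.eq_iff, ← h1]
    simp_rw [← map_smul, e.injective.eq_iff]
    constructor
    · intro hx
      have hf : τ x.fst = x.fst := congrArg DicksonDouble.fst hx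
      have hs : -x.snd = x.snd := congrArg DicksonDouble.snd hx
      obtain ⟨r, hr⟩ := (ih x.fst).1 hf
      refine ⟨r, DicksonDouble.ext (by simpa using hr) ?_⟩
      have h0 : (2 : F) • x.snd = 0 := by
        rw [two_smul]; nth_rewrite 1 [← hs]; simp
      simpa using (smul_eq_zero.1 h0).resolve_left h2
    · rintro ⟨r, rfl⟩
      refine DicksonDouble.ext ((ih _).2 ⟨r, by simp⟩) ?_
      change -(r • (0 : _)) = r • (0 : _)
      simp

/-- A Cayley algebra (octonion algebra) over `F` is an `8`-dimensional Cayley-Dickson algebra. -/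
def IsCayleyAlgebra (F : Type u) [Field F] (O : Type v) [NonAssocRing O] [Module F O]
    [IsScalarTower F O O] [SMulCommClass F O O] : Prop :=
  Module.finrank F O = 8 ∧ ∃ σ : AlgInvolution F O, IsCayleyDickson F O σ

/-! Induction along the doublings shows that a Cayley algebra is alternative, that its elements
satisfy quadratic equations, and that its trace form is nondegenerate. Nothing else about it is used
apart from its dimension. Alternativity makes the associator (a,b,c) alternating.

Dimension at most 4 implies associative: if (a,b,c) ≠ 0, then 1, a, b, c are independent and span A.
Since (ab,a,b) = 0, the product ab lies in span(1,a,b), and likewise for other pairs. This forces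
(a,b,c) to be a multiple of some a - y1 (`associator_eq_smul`) and, by cyclic symmetry, of some b -
w1, so it is 0.

Associative implies dimension at most 4: if dim A ≥ 5, the trace-zero part of A is too large to be
totally isotropic, so A contains u of trace zero with u² = μ1, μ ≠ 0. Let W be the trace-zero
elements of A that anticommute with u; dim W ≥ 3. By associativity WW centralises u, so it lies in
F1 + Fu, and the size of W then forces WW = 0. Testing W against elements of all of O shows that
such a W has dimension at most 2 (`finrank_le_two_of_mul_eq_zero`). -/

/-! ### How algebraic laws pass to a Dickson double -/

namespace DicksonDouble

variable {F B : Type*} [Field F] [NonAssocRing B] [Module F B]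
  {τ : AlgInvolution F B} {γ : F}

/-- The Dickson double as a direct sum of two copies of the algebra. -/
def equivProd (τ : AlgInvolution F B) (γ : F) : DicksonDouble τ γ ≃ₗ[F] B × B where
  toFun x := (x.fst, x.snd)
  invFun p := ⟨p.1, p.2⟩
  map_add' _ _ := rfl
  map_smul' _ _ := rfl
  left_inv _ := rfl
  right_inv _ := rfl

theorem finrank_eq (h : 1 ≤ Module.finrank F B) :
    Module.finrank F (DicksonDouble τ γ) = 2 * Module.finrank F B := by
  have : Module.Finite F B := Module.finite_of_finrank_pos h
  rw [(equivProd τ γ).finrank_eq, Module.finrank_prod, two_mul]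

theorem mul_comm_of (hτ : ∀ b, τ b = b) (hc : ∀ a b : B, a * b = b * a)
    (x y : DicksonDouble τ γ) : x * y = y * x := by
  ext
  · simp only [fst_mul, hτ, hc x.fst, hc x.snd]
  · simp only [snd_mul, hτ, hc x.fst, hc y.fst, add_comm]

@[simp] theorem fst_conj (x : DicksonDouble τ γ) : (conj τ γ x).fst = τ x.fst := rfl
@[simp] theorem snd_conj (x : DicksonDouble τ γ) : (conj τ γ x).snd = -x.snd := rfl

/-- The two summands B and iB are orthogonal, so testing against each of them isolates one component
of x. -/
theorem eq_zero_of_forall (hγ : γ ≠ 0) (hn : ∀ a : B, (∀ b, a * τ b + b * τ a = 0) → a = 0)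
    (x : DicksonDouble τ γ) (hx : ∀ y, x * conj τ γ y + y * conj τ γ x = 0) : x = 0 := by
  ext
  · refine hn _ fun b => ?_
    simpa using congrArg fst (hx ⟨b, 0⟩)
  · refine hn _ fun b => ?_
    have h := congrArg fst (hx ⟨0, b⟩)
    simp only [fst_add, fst_mul, fst_conj, snd_conj, map_zero, mul_zero, zero_add, zero_mul,
      neg_mul, smul_neg, fst_zero, ← neg_add, neg_eq_zero, ← smul_add] at h
    rw [add_comm]
    exact (smul_eq_zero.1 h).resolve_left hγ

variable [IsScalarTower F B B] [SMulCommClass F B B]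

theorem mul_assoc_of (hc : ∀ a b : B, a * b = b * a)
    (ha : ∀ a b c : B, (a * b) * c = a * (b * c))
    (x y z : DicksonDouble τ γ) : (x * y) * z = x * (y * z) := by
  have hl : ∀ a b c : B, a * (b * c) = b * (a * c) := fun a b c => by
    rw [← ha, hc a b, ha]
  ext
  · simp only [fst_mul, snd_mul, map_add, τ.map_mul_rev, τ.invol, mul_add, add_mul,
      smul_mul_assoc, mul_smul_comm, smul_add, ha]
    simp only [hc, hl]
    abel
  · simp only [fst_mul, snd_mul, map_add, map_smul, τ.map_mul_rev, τ.invol, mul_add, add_mul,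
      smul_mul_assoc, ha]
    rw [hc z.fst (y.fst * x.snd), ha, hc x.snd z.fst, hl z.fst, hc z.fst y.snd, hl (τ y.fst),
      hl x.snd, hl z.snd, hc z.snd x.snd]
    abel

/-- Once products in B are reassociated, every b τ(b) collapses to a scalar and the mixed terms
cancel. -/
theorem conj_mul_mul_of (hs : ∀ b : B, ∃ r : F, b * τ b = r • (1 : B) ∧ τ b * b = r • (1 : B))
    (ha : ∀ a b c : B, (a * b) * c = a * (b * c))
    (x y : DicksonDouble τ γ) : conj τ γ x * (x * y) = (conj τ γ x * x) * y := by
  obtain ⟨r, hr, hr'⟩ := hs x.fst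
  obtain ⟨s, hs, hs'⟩ := hs x.snd
  have h1 : ∀ b, x.fst * (τ x.fst * b) = r • b := fun b => by
    rw [← ha, hr, smul_mul_assoc, one_mul]
  have h2 : ∀ b, τ x.fst * (x.fst * b) = r • b := fun b => by
    rw [← ha, hr', smul_mul_assoc, one_mul]
  ext
  · simp only [fst_mul, snd_mul, fst_conj, snd_conj, map_add, map_neg, τ.map_mul_rev, τ.invol,
      mul_add, add_mul, smul_mul_assoc, mul_smul_comm, smul_add, ha, hr', hs, h2, mul_neg, neg_mul,
      smul_neg, mul_one, one_mul]
    simp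
    abel
  · simp only [fst_mul, snd_mul, fst_conj, snd_conj, map_add, map_smul, map_neg, τ.invol, mul_add,
      add_mul, smul_mul_assoc, mul_smul_comm, ha, hr', hs, hs', h1, mul_neg, neg_mul, smul_neg,
      mul_one, one_mul, τ.map_one]
    simp
    abel

end DicksonDouble

theorem AlgInvolution.IsStrong.exists_mul_eq {F A : Type*} [Field F] [NonAssocRing A] [Module F A]
    [IsScalarTower F A A] [SMulCommClass F A A] {σ : AlgInvolution F A} (h : σ.IsStrong) (a : A) :
    ∃ r : F, a * σ a = r • (1 : A) ∧ σ a * a = r • (1 : A) := by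
  obtain ⟨t, ht⟩ := (h (a + σ a)).1 (by rw [map_add, σ.invol, add_comm])
  obtain ⟨r, hr⟩ := (h (a * σ a)).1 (by rw [σ.map_mul_rev, σ.invol])
  refine ⟨r, hr, ?_⟩
  have h1 : σ a = t • 1 - a := eq_sub_of_add_eq' ht
  rw [← hr, h1]
  simp [mul_sub, sub_mul]

/-- The properties of Cayley-Dickson algebras that are proved simultaneously by induction. -/
theorem IsCayleyDickson.properties {F : Type u} [Field F] (hF : ringChar F ≠ 2) {A : Type v}
    [NonAssocRing A] [Module F A] [IsScalarTower F A A] [SMulCommClass F A A]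
    {σ : AlgInvolution F A} (h : IsCayleyDickson F A σ) :
    1 ≤ Module.finrank F A ∧ (∀ a, (∀ b, a * σ b + b * σ a = 0) → a = 0) ∧
    (Module.finrank F A ≤ 1 → ∀ a, σ a = a) ∧
    (Module.finrank F A ≤ 2 → ∀ a b : A, a * b = b * a) ∧
    (Module.finrank F A ≤ 4 → ∀ a b c : A, (a * b) * c = a * (b * c)) ∧
    (Module.finrank F A ≤ 8 → ∀ a b : A, σ a * (a * b) = (σ a * a) * b) := by
  have h2 : (2 : F) ≠ 0 := Ring.two_ne_zero hF
  induction h with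
  | base σ hdim hσ =>
    rename_i A _ _ _ _
    have : Nontrivial A := Module.nontrivial_of_finrank_pos (R := F) (by omega)
    have hs : ∀ a : A, ∃ r : F, r • (1 : A) = a := fun a =>
      exists_smul_eq_of_finrank_eq_one hdim (one_ne_zero (α := A)) a
    refine ⟨hdim.ge, fun a ha => ?_, fun _ => hσ, fun _ a b => ?_, fun _ a b c => ?_,
      fun _ a b => ?_⟩
    · have h0 := ha 1
      rw [hσ, hσ, mul_one, one_mul, ← two_smul F] at h0
      exact (smul_eq_zero.1 h0).resolve_left h2
    · obtain ⟨r, rfl⟩ := hs a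
      simp
    · obtain ⟨r, rfl⟩ := hs a
      simp [smul_mul_assoc]
    · obtain ⟨r, rfl⟩ := hs a
      simp [hσ, smul_mul_assoc]
  | double σ τ γ hγ hB e he_mul he_conj ih =>
    -- Each law for the double costs the preceding laws for the factor, whose dimension is half as
    -- large; hence the bounds 1, 2, 4, 8.
    obtain ⟨h1, hn, hid, hc, ha, -⟩ := ih
    have hd := e.finrank_eq
    rw [DicksonDouble.finrank_eq h1] at hd
    refine ⟨by omega, ?_, fun _ => by omega, fun hle => ?_, fun hle => ?_, fun hle => ?_⟩
    · refine e.surjective.forall.2 fun x hx => ?_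
      rw [DicksonDouble.eq_zero_of_forall hγ hn x fun y => ?_, map_zero]
      have := hx (e y)
      rwa [← he_conj, ← he_conj, ← he_mul, ← he_mul, ← map_add, e.map_eq_zero_iff] at this
    · refine e.surjective.forall₂.2 fun x y => ?_
      rw [← he_mul, ← he_mul, DicksonDouble.mul_comm_of (hid (by omega)) (hc (by omega))]
    · refine e.surjective.forall₃.2 fun x y z => ?_
      simp only [← he_mul]
      rw [DicksonDouble.mul_assoc_of (hc (by omega)) (ha (by omega))]
    · refine e.surjective.forall₂.2 fun x y => ?_
      simp only [← he_mul, ← he_conj]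
      rw [DicksonDouble.conj_mul_mul_of (hB.isStrong hF).exists_mul_eq (ha (by omega))]

theorem LinearIndependent.exists_relation_of_not {F V : Type*} [Field F] [AddCommGroup V]
    [Module F V] [Module.Finite F V] (h : Module.finrank F V < 5) (v : Fin 5 → V) :
    ∃ g : Fin 5 → F, g 0 • v 0 + g 1 • v 1 + g 2 • v 2 + g 3 • v 3 + g 4 • v 4 = 0 ∧
      ∃ i, g i ≠ 0 := by
  have hv : ¬ LinearIndependent F v := fun hv => by
    have := hv.fintype_card_le_finrank
    simp at this
    omega
  obtain ⟨g, hg, hi⟩ := Fintype.not_linearIndependent_iff.1 hv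
  exact ⟨g, by simpa [Fin.sum_univ_five] using hg, hi⟩

/-! ### Alternative algebras with a nondegenerate trace form -/

/-- An alternative algebra with an involution `σ` for which `x + σ x = t(x) 1` and `x * σ x` are
scalars, and whose trace form `t (x * σ y)` is nondegenerate. -/
structure IsAlternativeConic {F O : Type*} [Field F] [NonAssocRing O] [Module F O]
    (σ : AlgInvolution F O) (t : O →ₗ[F] F) : Prop where
  add_conj : ∀ x, x + σ x = t x • (1 : O)
  quadratic : ∀ x : O, ∃ n : F, x * x = t x • x - n • (1 : O)
  left_alt : ∀ x y : O, x * (x * y) = (x * x) * y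
  right_alt : ∀ x y : O, (y * x) * x = y * (x * x)
  nondegenerate : ∀ x, (∀ y, t (x * σ y) = 0) → x = 0

namespace IsAlternativeConic

variable {F O : Type*} [Field F] [NonAssocRing O] [Module F O]
  {σ : AlgInvolution F O} {t : O →ₗ[F] F}

section Basic

variable (h : IsAlternativeConic σ t)
include h

theorem conj_eq (x : O) : σ x = t x • (1 : O) - x := eq_sub_of_add_eq' (h.add_conj x)

theorem left_alt_add (x y z : O) : x * (y * z) + y * (x * z) = (x * y + y * x) * z := by
  have h1 := h.left_alt (x + y) z
  have h2 := h.left_alt x z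
  have h3 := h.left_alt y z
  simp only [add_mul, mul_add] at h1 ⊢
  linear_combination (norm := module) h1 - h2 - h3

theorem right_alt_add (x y z : O) : (z * x) * y + (z * y) * x = z * (x * y + y * x) := by
  have h1 := h.right_alt (x + y) z
  have h2 := h.right_alt x z
  have h3 := h.right_alt y z
  simp only [add_mul, mul_add] at h1 ⊢
  linear_combination (norm := module) h1 - h2 - h3

end Basic

variable [IsScalarTower F O O] [SMulCommClass F O O]

/-- Substituting σ(a) = t(a)1 - a into the hypothesis `ha` gives the left alternative law; applying
σ turns it into the right one. -/
theorem exists_of_isStrong [Nontrivial O] (hσ : σ.IsStrong)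
    (hn : ∀ a, (∀ b, a * σ b + b * σ a = 0) → a = 0)
    (ha : ∀ a b : O, σ a * (a * b) = (σ a * a) * b) :
    ∃ t : O →ₗ[F] F, IsAlternativeConic σ t := by
  have h1 : ∀ x, ∃ r : F, x + σ x = r • (1 : O) := fun x =>
    (hσ _).1 (by rw [map_add, σ.invol, add_comm])
  choose t ht using h1
  have hinj : Function.Injective fun r : F => r • (1 : O) :=
    smul_left_injective F (one_ne_zero (α := O))
  let t' : O →ₗ[F] F :=
    { toFun := t
      map_add' := fun x y => hinj <| by
        simp only [add_smul, ← ht, map_add]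
        abel
      map_smul' := fun r x => hinj <| by
        simp only [smul_eq_mul, mul_smul, ← ht, map_smul, RingHom.id_apply, smul_add] }
  have hc : ∀ x, σ x = t' x • 1 - x := fun x => eq_sub_of_add_eq' (ht x)
  have hl : ∀ x y : O, x * (x * y) = (x * x) * y := fun x y => by
    have := ha x y
    rw [hc] at this
    simpa [sub_mul, smul_mul_assoc] using this
  refine ⟨t', ht, fun x => ?_, hl, fun x y => ?_, fun x hx => hn x fun y => ?_⟩
  · obtain ⟨n, hn, -⟩ := hσ.exists_mul_eq x
    refine ⟨n, ?_⟩
    rw [← hn, hc]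
    simp [mul_sub, mul_smul_comm]
  · have := congrArg σ (hl (σ x) (σ y))
    simpa [σ.map_mul_rev, σ.invol] using this
  · have := ht (x * σ y)
    rw [σ.map_mul_rev, σ.invol] at this
    rw [this]
    exact (congrArg (· • (1 : O)) (hx y)).trans (zero_smul _ _)

end IsAlternativeConic

/-! ### Subalgebras of dimension at most 4 are associative -/

namespace IsAlternativeConic

variable {F O : Type*} [Field F] [NonAssocRing O] [Module F O]
  {σ : AlgInvolution F O} {t : O →ₗ[F] F}

theorem associator_rotate (h : IsAlternativeConic σ t) (a b c : O) :
    associator a b c = associator b c a := by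
  have h1 := h.left_alt_add a b c
  have h2 := h.right_alt_add a c b
  simp only [add_mul, mul_add] at h1 h2
  simp only [associator_apply]
  linear_combination (norm := module) -h1 - h2

theorem associator_swap (h : IsAlternativeConic σ t) (a b c : O) :
    associator a c b = -associator a b c := by
  have := h.right_alt_add b c a
  simp only [mul_add] at this
  simp only [associator_apply]
  linear_combination (norm := module) this

theorem associator_self_left (h : IsAlternativeConic σ t) (a b : O) : associator a a b = 0 := by
  rw [associator_apply, h.left_alt, sub_self]

theorem associator_self_outer (h : IsAlternativeConic σ t) (a b : O) : associator a b a = 0 := by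
  rw [h.associator_rotate, h.associator_rotate, h.associator_self_left]

/-- In the associator cocycle identity for a, a, b, b every term but (a,ab,b) has a repeated
argument. -/
theorem associator_mul_self (h : IsAlternativeConic σ t) (a b : O) :
    associator (a * b) a b = 0 := by
  have h1 : ∀ x y : O, associator x y y = 0 := fun x y => by
    rw [h.associator_rotate, h.associator_self_left]
  have h2 := associator_cocycle a a b b
  rw [h1, h1, h.associator_self_left, h.associator_self_left] at h2
  rw [h.associator_swap, ← h.associator_rotate]
  simpa using h2

variable [IsScalarTower F O O]

/-- The associator as a linear function of its first argument. -/
def associatorLeft (b c : O) : O →ₗ[F] O where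
  toFun a := associator a b c
  map_add' x y := by
    simp only [associator_apply, add_mul]
    abel
  map_smul' r x := by
    simp only [associator_apply, smul_mul_assoc, smul_sub, RingHom.id_apply]

@[simp] theorem associatorLeft_apply (a b c : O) :
    associatorLeft (F := F) b c a = associator a b c := rfl

/-- In a linear relation between `1` and the arguments of a nonzero associator, the coefficient of
the first argument vanishes. -/
theorem relation_left (h : IsAlternativeConic σ t) {a b c : O} {r s q p : F}
    (hr : r • (1 : O) + s • a + q • b + p • c = 0) :
    s • associator a b c = 0 := by
  have h1 := congrArg (associatorLeft (F := F) b c) hr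
  have hb : associator b b c = 0 := h.associator_self_left b c
  have hc : associator c b c = 0 := h.associator_self_outer c b
  simp only [map_add, map_smul, map_zero] at h1
  simpa [associator_apply (1 : O), hb, hc] using h1

variable [SMulCommClass F O O]

/-- In a subalgebra of dimension at most `4`, the product of two arguments of a nonzero associator is
a linear combination of `1` and these arguments. -/
theorem exists_mul_eq (h : IsAlternativeConic σ t) [Module.Finite F O]
    {A : NonUnitalSubalgebra F O} (hA : (1 : O) ∈ A) (hd : Module.finrank F A ≤ 4) {a b c : O}
    (ha : a ∈ A) (hb : b ∈ A) (hc : c ∈ A) (h0 : associator a b c ≠ 0) :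
    ∃ r s q : F, a * b = r • (1 : O) + s • a + q • b := by
  have : Nontrivial O := ⟨_, _, h0⟩
  have : Module.Finite F A := inferInstanceAs (Module.Finite F A.toSubmodule)
  obtain ⟨g, hg, i, hi⟩ := LinearIndependent.exists_relation_of_not (F := F) (V := A) (by omega)
    ![⟨1, hA⟩, ⟨a, ha⟩, ⟨b, hb⟩, ⟨c, hc⟩, ⟨a * b, A.mul_mem ha hb⟩]
  have hg' : g 0 • (1 : O) + g 1 • a + g 2 • b + g 3 • c + g 4 • (a * b) = 0 :=
    congrArg Subtype.val hg
  -- Applying (·,a,b) to the relation kills the terms in 1, a, b and ab, and leaves `g 3` times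
  -- (c,a,b) = (a,b,c).
  have h3 : g 3 = 0 := by
    have h1 := congrArg (associatorLeft (F := F) a b) hg'
    have e1 : associator b a b = 0 := h.associator_self_outer b a
    have e2 : associator c a b = associator a b c := h.associator_rotate c a b
    have e3 := h.associator_mul_self a b
    simp only [map_add, map_smul, map_zero] at h1
    simpa [associator_apply (1 : O), h.associator_self_left, e1, e2, e3, h0] using h1
  rw [h3, zero_smul, add_zero] at hg'
  -- Otherwise a nontrivial relation among 1, a, b would remain.
  have h4 : g 4 ≠ 0 := fun h4 => by
    rw [h4, zero_smul, add_zero] at hg'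
    have h1 : g 1 = 0 := (smul_eq_zero.1 (h.relation_left (c := c) (p := 0)
      (by simpa using hg'))).resolve_right h0
    have h2 : g 2 = 0 := by
      refine (smul_eq_zero.1 (h.relation_left (a := b) (b := c) (c := a) (r := g 0) (q := 0)
        (p := g 1) ?_)).resolve_right (by rwa [← h.associator_rotate])
      linear_combination (norm := module) hg'
    have h00 : g 0 = 0 := by simpa [h1, h2] using hg'
    fin_cases i <;> simp_all
  refine ⟨-(g 0 / g 4), -(g 1 / g 4), -(g 2 / g 4), ?_⟩
  have h5 : a * b = (g 4)⁻¹ • (g 4 • (a * b)) := by rw [smul_smul, inv_mul_cancel₀ h4, one_smul]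
  rw [h5, eq_neg_of_add_eq_zero_right hg']
  module

/-- Modulo span(1,a), left multiplication by a acts on b and c by one scalar q, and alternativity
improves this to (a - q)b, (a - q)c ∈ F(a - q). Expanding (ab)c - a(bc) with bc ∈ span(1,b,c) leaves
a multiple of a - q. -/
theorem associator_eq_smul (h : IsAlternativeConic σ t) [Module.Finite F O]
    {A : NonUnitalSubalgebra F O} (hA : (1 : O) ∈ A) (hd : Module.finrank F A ≤ 4) {a b c : O}
    (ha : a ∈ A) (hb : b ∈ A) (hc : c ∈ A) (h0 : associator a b c ≠ 0) :
    ∃ x y : F, associator a b c = x • (a - y • (1 : O)) := by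
  have hi : ∀ {r s q p : F}, r • (1 : O) + s • a + q • b + p • c = 0 → s = 0 := fun hr =>
    (smul_eq_zero.1 (h.relation_left hr)).resolve_right h0
  have hbca : associator b c a ≠ 0 := by rwa [← h.associator_rotate]
  have hi2 : ∀ {r s q p : F}, r • (1 : O) + s • a + q • b + p • c = 0 → q = 0 := fun hr =>
    (smul_eq_zero.1 (h.relation_left (b := c) (c := a)
      ((by module : _ = _).trans hr))).resolve_right hbca
  have hcab : associator c a b ≠ 0 := by rwa [h.associator_rotate]
  have hi3 : ∀ {r s q p : F}, r • (1 : O) + s • a + q • b + p • c = 0 → p = 0 := fun hr =>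
    (smul_eq_zero.1 (h.relation_left (b := a) (c := b)
      ((by module : _ = _).trans hr))).resolve_right hcab
  -- The product a(b + c) serves to compare the coefficient of b in ab with that of c in ac.
  have hsum : associator a (b + c) c = associator a b c := by
    have : associator a c c = 0 := by rw [h.associator_rotate, h.associator_self_left]
    rw [← add_zero (associator a b c), ← this]
    simp only [associator_apply, mul_add, add_mul]
    abel
  obtain ⟨r₁, s₁, q₁, h₁⟩ := h.exists_mul_eq hA hd ha hb hc h0
  obtain ⟨r₂, s₂, q₂, h₂⟩ := h.exists_mul_eq hA hd ha hc hb (by rwa [h.associator_swap, neg_ne_zero])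
  obtain ⟨r₃, s₃, q₃, h₃⟩ := h.exists_mul_eq hA hd ha (A.add_mem hb hc) hc (by rwa [hsum])
  obtain ⟨r₄, s₄, q₄, h₄⟩ := h.exists_mul_eq hA hd hb hc ha hbca
  rw [mul_add, h₁, h₂] at h₃
  have e1 : q₁ - q₃ = 0 := by
    refine hi2 (r := r₁ + r₂ - r₃) (s := s₁ + s₂ - s₃) (p := q₂ - q₃) ?_
    linear_combination (norm := module) h₃
  have e2 : q₂ - q₃ = 0 := by
    refine hi3 (r := r₁ + r₂ - r₃) (s := s₁ + s₂ - s₃) (q := q₁ - q₃) ?_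
    linear_combination (norm := module) h₃
  obtain rfl : q₁ = q₃ := sub_eq_zero.1 e1
  obtain rfl : q₂ = q₁ := sub_eq_zero.1 e2
  obtain ⟨n, hn⟩ := h.quadratic a
  -- The coefficient of a in a(ad) = a²d gives r = -sq, that is, (a - q)d = s(a - q).
  have key : ∀ {d : O} {r s : F}, a * d = r • (1 : O) + s • a + q₂ • d →
      (∀ {x y z : F}, x • (1 : O) + y • a + z • d = 0 → y = 0) → r = -(s * q₂) := by
    intro d r s hd hy
    have h5 := h.left_alt a d
    rw [hn, hd] at h5
    simp only [mul_add, sub_mul, smul_mul_assoc, mul_smul_comm, mul_one, one_mul, hd, hn] at h5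
    have := hy (x := q₂ * r - s * n - t a * r) (y := r + s * t a + q₂ * s - t a * s)
      (z := q₂ * q₂ - t a * q₂ + n) (by linear_combination (norm := module) h5)
    linear_combination this
  have f1 := key h₁ fun {x y z} hh => hi (r := x) (q := z) (p := 0) (by simpa using hh)
  have f2 := key h₂ fun {x y z} hh => hi (r := x) (p := z) (q := 0) (by simpa using hh)
  subst f1 f2
  refine ⟨s₁ * s₂ - r₄ - s₄ * s₁ - q₄ * s₂, q₂, ?_⟩
  rw [associator_apply, h₄, h₁]
  simp only [mul_add, add_mul, smul_mul_assoc, mul_smul_comm, mul_one, one_mul, h₁, h₂, h₄]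
  module

theorem associator_eq_zero_of_finrank_le (h : IsAlternativeConic σ t) [Module.Finite F O]
    {A : NonUnitalSubalgebra F O} (hA : (1 : O) ∈ A) (hd : Module.finrank F A ≤ 4) {a b c : O}
    (ha : a ∈ A) (hb : b ∈ A) (hc : c ∈ A) : associator a b c = 0 := by
  by_contra h0
  have hbca : associator b c a ≠ 0 := by rwa [← h.associator_rotate]
  have hcab : associator c a b ≠ 0 := by rwa [h.associator_rotate]
  obtain ⟨x, y, h1⟩ := h.associator_eq_smul hA hd ha hb hc h0
  obtain ⟨z, w, h2⟩ := h.associator_eq_smul hA hd hb hc ha hbca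
  rw [← h.associator_rotate] at h2
  have hx : x = 0 := by
    refine (smul_eq_zero.1 (h.relation_left (r := z * w - x * y) (q := -z) (p := 0)
      ?_)).resolve_right h0
    linear_combination (norm := module) h2 - h1
  exact h0 (by rw [h1, hx, zero_smul])

end IsAlternativeConic

/-! ### Dimension counts, and identities for trace-zero elements -/

theorem Submodule.exists_mem_forall_ne_of_two_lt_finrank {F V : Type*} [Field F] [AddCommGroup V]
    [Module F V] [Module.Finite F V] {W : Submodule F V} (hW : 2 < Module.finrank F W) (x y : V) :
    ∃ w ∈ W, ∀ r s : F, w ≠ r • x + s • y := by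
  classical
  by_contra! hc
  have hle : W ≤ Submodule.span F (({x, y} : Finset V) : Set V) := fun w hw => by
    obtain ⟨r, s, rfl⟩ := hc w hw
    refine add_mem (Submodule.smul_mem _ _ (Submodule.subset_span ?_))
      (Submodule.smul_mem _ _ (Submodule.subset_span ?_)) <;> simp
  have h1 := Submodule.finrank_mono hle
  have h2 := finrank_span_finset_le_card (R := F) ({x, y} : Finset V)
  rw [Set.finrank] at h2
  have h3 := Finset.card_le_two (a := x) (b := y)
  omega

theorem Submodule.finrank_le_finrank_inf_ker_add {F V V' : Type*} [Field F] [AddCommGroup V]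
    [Module F V] [Module.Finite F V] [AddCommGroup V'] [Module F V'] [Module.Finite F V']
    (p : Submodule F V) (f : V →ₗ[F] V') :
    Module.finrank F p ≤ Module.finrank F (p ⊓ LinearMap.ker f : Submodule F V) +
      Module.finrank F V' := by
  have h1 := Submodule.finrank_sup_add_finrank_inf_eq p (LinearMap.ker f)
  have h2 := f.finrank_range_add_finrank_ker
  have h3 := Submodule.finrank_le (p ⊔ LinearMap.ker f)
  have h4 := Submodule.finrank_le (LinearMap.range f)
  omega

namespace IsAlternativeConic

variable {F O : Type*} [Field F] [NonAssocRing O] [Module F O]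
  {σ : AlgInvolution F O} {t : O →ₗ[F] F}

section Trace

variable (h : IsAlternativeConic σ t)
include h

theorem conj_of_trace_eq_zero {x : O} (hx : t x = 0) : σ x = -x := by
  rw [h.conj_eq, hx, zero_smul, zero_sub]

theorem exists_mul_self_eq {x : O} (hx : t x = 0) : ∃ n : F, x * x = n • (1 : O) := by
  obtain ⟨n, hn⟩ := h.quadratic x
  exact ⟨-n, by rw [hn, hx, zero_smul, zero_sub, neg_smul]⟩

theorem mul_add_mul {x y : O} (hx : t x = 0) (hy : t y = 0) :
    x * y + y * x = t (x * y) • (1 : O) := by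
  rw [← h.add_conj, σ.map_mul_rev, h.conj_of_trace_eq_zero hx, h.conj_of_trace_eq_zero hy, neg_mul,
    mul_neg, neg_neg]

theorem trace_one [Nontrivial O] : t 1 = 2 := by
  have h1 := h.add_conj 1
  rw [σ.map_one] at h1
  refine smul_left_injective F (one_ne_zero (α := O)) ?_
  simp only [← h1, two_smul]

theorem trace_sub_half [Nontrivial O] (h2 : (2 : F) ≠ 0) (y : O) : t (y - (t y / 2) • (1 : O)) = 0 := by
  rw [map_sub, map_smul, h.trace_one, smul_eq_mul, div_mul_cancel₀ _ h2, sub_self]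

variable [IsScalarTower F O O]

theorem mul_add_mul' {u : O} (hu : t u = 0) (p : O) :
    u * p + p * u = t p • u + t (u * p) • (1 : O) := by
  rw [← h.add_conj, σ.map_mul_rev, h.conj_of_trace_eq_zero hu, h.conj_eq p]
  simp only [sub_mul, mul_neg, smul_mul_assoc, one_mul]
  abel

variable [SMulCommClass F O O]

/-- Here ux + xu = 2ux lies in span(1,u); multiplying by u recovers 2μx. -/
theorem exists_eq_of_commute (h2 : (2 : F) ≠ 0) {u x : O} {μ : F} (hu : t u = 0)
    (hμ : u * u = μ • (1 : O)) (h0 : μ ≠ 0) (hc : u * x = x * u) :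
    ∃ r s : F, x = r • (1 : O) + s • u := by
  have h1 := h.mul_add_mul' hu x
  rw [← hc] at h1
  have h3 := congrArg (u * ·) h1
  have h4 := h.left_alt u x
  simp only [mul_add, mul_smul_comm, mul_one, hμ, smul_mul_assoc, one_mul] at h3 h4
  rw [h4] at h3
  have h5 : x = (2 * μ)⁻¹ • (μ • x + μ • x) := by
    rw [← two_smul F, smul_smul, smul_smul, mul_assoc, inv_mul_cancel₀ (mul_ne_zero h2 h0), one_smul]
  refine ⟨(2 * μ)⁻¹ * (t x * μ), (2 * μ)⁻¹ * t (u * x), ?_⟩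
  refine h5.trans ?_
  rw [h3]
  module

variable [Nontrivial O]

theorem trace_mul_comm (x y : O) : t (x * y) = t (y * x) := by
  have h1 : t (σ (x * y)) = t (x * y) := by
    rw [h.conj_eq, map_sub, map_smul, h.trace_one, smul_eq_mul]
    ring
  rw [← h1, σ.map_mul_rev, h.conj_eq, h.conj_eq]
  simp only [mul_sub, sub_mul, smul_mul_assoc, mul_smul_comm, mul_one, one_mul, map_sub, map_smul,
    h.trace_one, smul_eq_mul]
  ring

theorem exists_trace_mul_ne_zero (h2 : (2 : F) ≠ 0) {v : O} (hv : t v = 0) (h0 : v ≠ 0) :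
    ∃ z, t z = 0 ∧ t (v * z) ≠ 0 := by
  by_contra! hc
  refine h0 (h.nondegenerate v fun y => ?_)
  have h1 := hc _ (h.trace_sub_half h2 y)
  rw [h.conj_eq]
  simp only [mul_sub, mul_smul_comm, mul_one, map_sub, map_smul, hv, smul_zero, zero_sub,
    neg_eq_zero, sub_zero] at h1 ⊢
  exact h1

/-- The trace form `(x, y) ↦ t (x * σ y)`. -/
def traceForm (σ : AlgInvolution F O) (t : O →ₗ[F] F) : LinearMap.BilinForm F O :=
  LinearMap.mk₂ F (fun x y => t (x * σ y)) (by simp [add_mul]) (by simp [smul_mul_assoc])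
    (by simp [mul_add]) (by simp [mul_smul_comm])

theorem traceForm_nondegenerate : (traceForm σ t).Nondegenerate := by
  have hr : (traceForm σ t).IsRefl := fun x y hxy => by
    have h1 : t (σ (x * σ y)) = t (x * σ y) := by
      rw [h.conj_eq, map_sub, map_smul, h.trace_one, smul_eq_mul]
      ring
    rw [σ.map_mul_rev, σ.invol] at h1
    exact h1.trans hxy
  exact hr.nondegenerate_iff_separatingLeft.2 h.nondegenerate

/-- If all trace-zero squares in A vanish, polarisation makes the trace-zero part A₀ orthogonal to
all of A. Then dim A + dim A₀ ≤ dim O with dim A₀ ≥ dim A - 1, contrary to `hd`. -/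
theorem exists_mul_self_ne_zero [Module.Finite F O] (h2 : (2 : F) ≠ 0)
    {A : NonUnitalSubalgebra F O} (hA : (1 : O) ∈ A)
    (hd : Module.finrank F O + 1 < 2 * Module.finrank F A) :
    ∃ u ∈ A, t u = 0 ∧ u * u ≠ 0 := by
  by_contra! hc
  set A₀ : Submodule F O := A.toSubmodule ⊓ LinearMap.ker t
  have hle : A.toSubmodule ≤ (traceForm σ t).orthogonal A₀ := by
    rintro y (hy : y ∈ A) x ⟨hx : x ∈ A, hxt : t x = 0⟩
    have hz : y - (t y / 2) • (1 : O) ∈ A := A.toSubmodule.sub_mem hy (A.toSubmodule.smul_mem _ hA)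
    have hzt := h.trace_sub_half h2 y
    have h1 := h.mul_add_mul hxt hzt
    have h3 := hc _ (A.add_mem hx hz) (by rw [map_add, hxt, hzt, add_zero])
    have h4 := hc _ hx hxt
    have h5 := hc _ hz hzt
    have h6 : t (x * (y - (t y / 2) • (1 : O))) • (1 : O) = 0 := by
      rw [← h1]
      generalize y - (t y / 2) • (1 : O) = z at *
      simp only [mul_add, add_mul, h4, h5] at h3
      linear_combination (norm := module) h3
    have h7 := (smul_eq_zero.1 h6).resolve_right one_ne_zero
    change t (x * σ y) = 0
    rw [h.conj_eq]
    simp only [mul_sub, mul_smul_comm, mul_one, map_sub, map_smul, hxt, smul_zero, sub_zero] at h7 ⊢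
    rw [h7, sub_zero]
  have e1 := Submodule.finrank_mono hle
  have e2 := A.toSubmodule.finrank_le_finrank_inf_ker_add t
  rw [LinearMap.BilinForm.finrank_orthogonal h.traceForm_nondegenerate] at e1
  rw [Module.finrank_self] at e2
  change Module.finrank F A ≤ _ at e1
  change Module.finrank F A ≤ Module.finrank F A₀ + 1 at e2
  omega

end Trace

end IsAlternativeConic

/-! ### Associative subalgebras have dimension at most 4 -/

namespace IsAlternativeConic

variable {F O : Type*} [Field F] [NonAssocRing O] [Module F O] [IsScalarTower F O O]
  [SMulCommClass F O O] {σ : AlgInvolution F O} {t : O →ₗ[F] F}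

section Isotropic

variable (h : IsAlternativeConic σ t)
include h

/-- The linearised law w(zv) + z(wv) = (wz + zw)v, with zv = t(vz)1 - vz. -/
theorem mul_mul_of_mul_eq_zero {w v z : O} (hw : t w = 0) (hv : t v = 0) (hz : t z = 0)
    (h0 : w * v = 0) : w * (v * z) = t (v * z) • w - t (w * z) • v := by
  have h1 := h.left_alt_add w z v
  have h3 := eq_sub_of_add_eq' (h.mul_add_mul hv hz)
  rw [h0, mul_zero, add_zero, h.mul_add_mul hw hz, h3] at h1
  simp only [mul_sub, mul_smul_comm, mul_one, smul_mul_assoc, one_mul] at h1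
  linear_combination (norm := module) -h1

/-- Linearised right alternativity for w and the pair u, vz; the preceding lemma evaluates w(vz) and
(wu)(vz). -/
theorem exists_smul_add_smul_eq {u w v z : O} (hu : t u = 0) (hw : t w = 0) (hwu : t (w * u) = 0)
    (hv : t v = 0) (hz : t z = 0) (h0 : w * v = 0) (h1 : (w * u) * v = 0) :
    ∃ x y : F, t (w * z) • (v * u) + t ((w * u) * z) • v = x • w + y • (w * u) := by
  have e1 := h.right_alt_add u (v * z) w
  rw [h.mul_mul_of_mul_eq_zero hw hv hz h0, h.mul_mul_of_mul_eq_zero hwu hv hz h1,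
    h.mul_add_mul' hu] at e1
  simp only [mul_add, sub_mul, mul_smul_comm, mul_one, smul_mul_assoc] at e1
  refine ⟨-t (u * (v * z)), t (v * z), ?_⟩
  linear_combination (norm := module) -e1

/-- If dim W > 2, the preceding relation makes every w ∈ W an eigenvector of right multiplication by
u, with opposite eigenvalues on independent vectors. Three independent vectors then force the
eigenvalue 0, against (wu)u = μw. -/
theorem finrank_le_two_of_mul_eq_zero [Nontrivial O] [Module.Finite F O] (h2 : (2 : F) ≠ 0) {u : O}
    {μ : F} (hu : t u = 0) (hμ : u * u = μ • (1 : O)) (hμ0 : μ ≠ 0) {W : Submodule F O}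
    (ht : ∀ w ∈ W, t w = 0) (hWu : ∀ w ∈ W, w * u ∈ W) (h0 : ∀ w ∈ W, ∀ v ∈ W, w * v = 0) :
    Module.finrank F W ≤ 2 := by
  by_contra! hd
  have key : ∀ w ∈ W, ∀ v ∈ W, ∀ z, t z = 0 →
      ∃ x y : F, t (w * z) • (v * u) + t ((w * u) * z) • v = x • w + y • (w * u) :=
    fun w hw v hv z hz => h.exists_smul_add_smul_eq hu (ht w hw) (ht _ (hWu w hw)) (ht v hv) hz
      (h0 w hw v hv) (h0 _ (hWu w hw) v hv)
  have eig : ∀ w ∈ W, ∃ c : F, w * u = c • w := by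
    intro w hw
    by_contra! hc
    have hw0 : w ≠ 0 := fun hw0 => hc 0 (by simp [hw0])
    obtain ⟨z₀, hz₀, hα⟩ := h.exists_trace_mul_ne_zero h2 (ht w hw) hw0
    -- With these c and d, the element z - d z₀ pairs to 0 with w, and its pairing with wu is t((wu
    -- - cw)z) ≠ 0. The relation then puts every v ∈ W in span(w,wu).
    set c := t ((w * u) * z₀) / t (w * z₀) with hcdef
    have hcα : c * t (w * z₀) = t ((w * u) * z₀) := div_mul_cancel₀ _ hα
    obtain ⟨z, hz, hβ⟩ := h.exists_trace_mul_ne_zero h2 (v := w * u - c • w)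
      (ht _ (W.sub_mem (hWu w hw) (W.smul_mem c hw))) (sub_ne_zero.2 (hc c))
    set d := t (w * z) / t (w * z₀)
    have hdα : d * t (w * z₀) = t (w * z) := div_mul_cancel₀ _ hα
    have hz' : t (z - d • z₀) = 0 := by simp [hz, hz₀]
    have hwz : t (w * (z - d • z₀)) = 0 := by
      simp [mul_sub, mul_smul_comm, hdα]
    have hwuz : t ((w * u) * (z - d • z₀)) ≠ 0 := by
      refine fun h3 => hβ ?_
      simp only [mul_sub, sub_mul, mul_smul_comm, smul_mul_assoc, map_sub, map_smul,
        smul_eq_mul] at h3 ⊢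
      linear_combination h3 - d * hcα + c * hdα
    obtain ⟨v, hv, hne⟩ := Submodule.exists_mem_forall_ne_of_two_lt_finrank hd w (w * u)
    obtain ⟨x, y, hxy⟩ := key w hw v hv _ hz'
    rw [hwz, zero_smul, zero_add] at hxy
    set β := t ((w * u) * (z - d • z₀))
    refine hne (β⁻¹ * x) (β⁻¹ * y) ?_
    rw [mul_smul, mul_smul, ← smul_add, ← hxy, smul_smul, inv_mul_cancel₀ hwuz, one_smul]
  -- For eigenvectors the relation reads t(wz)(d + c)v ∈ Fw.
  have opp : ∀ w ∈ W, ∀ v ∈ W, w ≠ 0 → (∀ r : F, v ≠ r • w) → ∀ c d : F, w * u = c • w →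
      v * u = d • v → d + c = 0 := by
    intro w hw v hv hw0 hne c d hc hd
    by_contra hcd
    obtain ⟨z, hz, hα⟩ := h.exists_trace_mul_ne_zero h2 (ht w hw) hw0
    obtain ⟨x, y, hxy⟩ := key w hw v hv z hz
    rw [hc, hd, smul_mul_assoc, map_smul, smul_eq_mul] at hxy
    refine hne ((t (w * z) * (d + c))⁻¹ * (x + y * c)) ?_
    have : (t (w * z) * (d + c)) • v = (x + y * c) • w := by
      linear_combination (norm := module) hxy
    rw [mul_smul, ← this, smul_smul, inv_mul_cancel₀ (mul_ne_zero hα hcd), one_smul]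
  obtain ⟨w₁, hw₁, hn₁⟩ := Submodule.exists_mem_forall_ne_of_two_lt_finrank hd 0 0
  obtain ⟨w₂, hw₂, hn₂⟩ := Submodule.exists_mem_forall_ne_of_two_lt_finrank hd w₁ 0
  obtain ⟨w₃, hw₃, hn₃⟩ := Submodule.exists_mem_forall_ne_of_two_lt_finrank hd w₁ w₂
  have hz₁ : w₁ ≠ 0 := by simpa using hn₁ 0 0
  have hz₂ : w₂ ≠ 0 := by simpa using hn₂ 0 0
  obtain ⟨c₁, hc₁⟩ := eig w₁ hw₁
  obtain ⟨c₂, hc₂⟩ := eig w₂ hw₂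
  obtain ⟨c₃, hc₃⟩ := eig w₃ hw₃
  have e12 := opp w₁ hw₁ w₂ hw₂ hz₁ (fun r => by simpa using hn₂ r 0) _ _ hc₁ hc₂
  have e13 := opp w₁ hw₁ w₃ hw₃ hz₁ (fun r => by simpa using hn₃ r 0) _ _ hc₁ hc₃
  have e23 := opp w₂ hw₂ w₃ hw₃ hz₂ (fun r => by simpa using hn₃ 0 r) _ _ hc₂ hc₃
  have hc0 : c₁ = 0 := by
    refine (mul_eq_zero.1 (?_ : 2 * c₁ = 0)).resolve_left h2
    linear_combination e12 + e13 - e23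
  have h3 := h.right_alt u w₁
  rw [hc₁, hc0, zero_smul, zero_mul, hμ, mul_smul_comm, mul_one] at h3
  exact (smul_ne_zero hμ0 hz₁) h3.symm

end Isotropic

theorem finrank_le_four_of_assoc (h : IsAlternativeConic σ t) [Nontrivial O] [Module.Finite F O]
    (h2 : (2 : F) ≠ 0) (hO : Module.finrank F O = 8) {A : NonUnitalSubalgebra F O}
    (hA : (1 : O) ∈ A) (ha : ∀ x ∈ A, ∀ y ∈ A, ∀ z ∈ A, (x * y) * z = x * (y * z)) :
    Module.finrank F A ≤ 4 := by
  by_contra! hd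
  obtain ⟨u, huA, hu, hu0⟩ := h.exists_mul_self_ne_zero h2 hA (by omega)
  obtain ⟨μ, hμ⟩ := h.exists_mul_self_eq hu
  have hμ0 : μ ≠ 0 := fun h0 => hu0 (by rw [hμ, h0, zero_smul])
  -- Two linear conditions on A, so dim W ≥ 5 - 2; for trace-zero w, t(uw) = 0 means uw = -wu.
  set W : Submodule F O := A.toSubmodule ⊓ LinearMap.ker (t.prod (t ∘ₗ LinearMap.mulLeft F u))
    with hW
  have hmem : ∀ w, w ∈ W ↔ w ∈ A ∧ t w = 0 ∧ t (u * w) = 0 := fun w => by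
    rw [hW]
    simp
  have hWd : 2 < Module.finrank F W := by
    have e := A.toSubmodule.finrank_le_finrank_inf_ker_add (t.prod (t ∘ₗ LinearMap.mulLeft F u))
    rw [Module.finrank_prod, Module.finrank_self] at e
    change Module.finrank F A ≤ Module.finrank F W + (1 + 1) at e
    omega
  have hanti : ∀ w ∈ W, u * w = -(w * u) := fun w hw => by
    obtain ⟨-, hw1, hw2⟩ := (hmem w).1 hw
    rw [eq_neg_iff_add_eq_zero, h.mul_add_mul hu hw1, hw2, zero_smul]
  have ht : ∀ w ∈ W, t w = 0 := fun w hw => ((hmem w).1 hw).2.1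
  have hWA : ∀ w ∈ W, w ∈ A := fun w hw => ((hmem w).1 hw).1
  have hWu : ∀ w ∈ W, w * u ∈ W := fun w hw => by
    obtain ⟨hw0, hw1, hw2⟩ := (hmem w).1 hw
    refine (hmem _).2 ⟨A.mul_mem hw0 huA, by rw [← h.trace_mul_comm, hw2], ?_⟩
    rw [← neg_eq_iff_eq_neg.2 (hanti w hw), mul_neg, h.left_alt, hμ, smul_mul_assoc, one_mul,
      map_neg, map_smul, hw1, smul_zero, neg_zero]
  have hcomm : ∀ w ∈ W, ∀ v ∈ W, ∃ r s : F, w * v = r • (1 : O) + s • u := fun w hw v hv => by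
    refine h.exists_eq_of_commute h2 hu hμ hμ0 ?_
    rw [← ha u huA w (hWA w hw) v (hWA v hv), hanti w hw, neg_mul,
      ha w (hWA w hw) u huA v (hWA v hv), hanti v hv, mul_neg, neg_neg,
      ha w (hWA w hw) v (hWA v hv) u huA]
  have hsq : ∀ w ∈ W, w * w = 0 := fun w hw => by
    by_contra hw0
    obtain ⟨ν, hν⟩ := h.exists_mul_self_eq (ht w hw)
    have hν0 : ν ≠ 0 := fun h0 => hw0 (by rw [hν, h0, zero_smul])
    -- But w(wv) = νv, and wv ∈ F1 + Fu puts it in span(w,wu).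
    obtain ⟨v, hv, hne⟩ := Submodule.exists_mem_forall_ne_of_two_lt_finrank hWd w (w * u)
    obtain ⟨r, s, hrs⟩ := hcomm w hw v hv
    have h3 := h.left_alt w v
    rw [hrs, hν, smul_mul_assoc, one_mul, mul_add, mul_smul_comm, mul_smul_comm, mul_one] at h3
    refine hne (ν⁻¹ * r) (ν⁻¹ * s) ?_
    rw [mul_smul, mul_smul, ← smul_add, h3, smul_smul, inv_mul_cancel₀ hν0, one_smul]
  have hmul : ∀ w ∈ W, ∀ v ∈ W, ∃ s : F, w * v = s • u := fun w hw v hv => by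
    obtain ⟨r, s, hrs⟩ := hcomm w hw v hv
    -- Polarising w² = 0 gives t(wv) = 0, which removes the component of wv along 1.
    have h3 := hsq _ (W.add_mem hw hv)
    rw [mul_add, add_mul, add_mul, hsq w hw, hsq v hv, zero_add, add_zero, add_comm,
      h.mul_add_mul (ht w hw) (ht v hv), hrs] at h3
    have h4 := (smul_eq_zero.1 h3).resolve_right one_ne_zero
    rw [map_add, map_smul, map_smul, hu, smul_zero, add_zero, h.trace_one, smul_eq_mul] at h4
    exact ⟨s, by rw [hrs, (mul_eq_zero.1 h4).resolve_right h2, zero_smul, zero_add]⟩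
  have hzero : ∀ w ∈ W, ∀ v ∈ W, w * v = 0 := fun w hw v hv => by
    obtain ⟨s, hs⟩ := hmul w hw v hv
    -- The product (wu)v lies in Fu, yet equals -(wv)u = -sμ1; taking traces gives s = 0.
    obtain ⟨r, hr⟩ := hmul _ (hWu w hw) v hv
    rw [ha w (hWA w hw) u huA v (hWA v hv), hanti v hv, mul_neg,
      ← ha w (hWA w hw) v (hWA v hv) u huA, hs, smul_mul_assoc, hμ, smul_smul] at hr
    have h3 := congrArg t hr
    rw [map_neg, map_smul, map_smul, hu, smul_zero, h.trace_one, smul_eq_mul, neg_eq_zero] at h3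
    have h4 := (mul_eq_zero.1 ((mul_eq_zero.1 h3).resolve_right h2)).resolve_right hμ0
    rw [hs, h4, zero_smul]
  have := h.finrank_le_two_of_mul_eq_zero h2 hu hμ hμ0 ht hWu hzero
  omega

end IsAlternativeConic

theorem mainTheorem7 {F : Type*} [Field F] (hF : ringChar F ≠ 2)
    {O : Type*} [NonAssocRing O] [Module F O] [IsScalarTower F O O] [SMulCommClass F O O]
    (hO : IsCayleyAlgebra F O) (A : NonUnitalSubalgebra F O) (hA : (1 : O) ∈ A) :
    ((∀ x y z : A, (x * y) * z = x * (y * z)) ↔ Module.finrank F A ≤ 4) ∧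
      (Module.finrank F A = 4 → ∀ x y z : A, (x * y) * z = x * (y * z)) := by
  obtain ⟨hd, σ, hσ⟩ := hO
  have h2 : (2 : F) ≠ 0 := Ring.two_ne_zero hF
  have : Nontrivial O := Module.nontrivial_of_finrank_pos (R := F) (by omega)
  have : Module.Finite F O := Module.finite_of_finrank_pos (by omega)
  obtain ⟨-, hn, -, -, -, ha⟩ := hσ.properties hF
  obtain ⟨t, h⟩ := IsAlternativeConic.exists_of_isStrong (hσ.isStrong hF) hn (ha hd.le)
  have key : Module.finrank F A ≤ 4 → ∀ x y z : A, (x * y) * z = x * (y * z) := fun hle x y z =>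
    Subtype.ext (sub_eq_zero.1
      (h.associator_eq_zero_of_finrank_le hA hle x.2 y.2 z.2))
  refine ⟨⟨fun hass => ?_, key⟩, fun h4 => key h4.le⟩
  exact h.finrank_le_four_of_assoc h2 hd hA fun x hx y hy z hz =>
    congrArg Subtype.val (hass ⟨x, hx⟩ ⟨y, hy⟩ ⟨z, hz⟩)
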